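/- **Setting.** Let $d>2$, $T>0$, $\mathbb T^d=\mathbb R^d/\mathbb Z^d$. Let $H:\mathbb T^d\times\mathbb R^d\to\mathbb R$, $g:[0,\infty)\to\mathbb R$ and $u_0,m_0\in C^\infty(\mathbb T^d)$ satisfy: - (A1) $H$ is smooth, $p\mapsto H(x,p)$ is strictly convex for every $x$, $\lim_{|p|\to\infty}H(x,p)/|p|=+\infty$ for every $x$, and $H\ge 1$; moreover $m_0\ge 0$ and $\int_{\mathbb T^d}m_0=1$. - (A2) $g$ is non-negative and increasing. - (A3) For some $c,C>0$, $D_pH(x,p)\cdot p-H(x,p)\ge cH(x,p)-C$ for all $x,p$. - (A4) $g(z)=z^\alpha$ for some $\alpha>0$. - (A5) $|D_xH|,|D^2_{xx}H|\le CH+C$ for some $C$, and for every $\delta>0$ there is $C_\delta$ such that $\operatorname{Tr}(D^2_{px}H\,M)\le\delta\operatorname{Tr}(D^2_{pp}H\,M^2)+C_\delta H$ for all $(x,p)$ and all symmetric matrices $M$. - (A6) $m_0\ge\kappa_0$ for some $\kappa_0>0$. - (A7) $H(x,p)\le C|p|^\gamma+C$ for some $C$ and some $1+\frac1{d+1}<\gamma<2$.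 Let $\eta\in C_c^\infty(\mathbb R^d)$ be non-negative and symmetric with $\int\eta=1$. For $\varepsilon>0$ put $\eta_\varepsilon(z)=\varepsilon^{-d}\eta(z/\varepsilon)$ and $g_\varepsilon(m)=\eta_\varepsilon*g(\eta_\varepsilon*m)$ (convolutions in $x$), and put $g_0(m)=g(m)$. For $\varepsilon\ge0$, a solution $(u^\varepsilon,m^\varepsilon)$ is a pair of continuous functions on $\mathbb T^d\times[0,T]$ that have continuous derivatives $\partial_t$, $D_x$, $D^2_{xx}$ on $\mathbb T^d\times(0,T)$, with $m^\varepsilon\ge0$, and satisfy $$\begin{cases}-u^\varepsilon_t+H(x,Du^\varepsilon)=\Delta u^\varepsilon+g_\varepsilon(m^\varepsilon)\\ m^\varepsilon_t-\operatorname{div}\big(D_pH(x,Du^\varepsilon)\,m^\varepsilon\big)=\Delta m^\varepsilon\end{cases}\quad\text{in }\mathbb T^d\times(0,T),\qquad u^\varepsilon(x,T)=u_0(x),\quad m^\varepsilon(x,0)=m_0(x).$$ **Lemma 1.3.** Let $a,b>1$ be real numbers with $$\frac d2<\frac{b(a-1)}a.$$ Then there is a constant $C>0$, independent of $\varepsilon$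 and of the solution, such that for every $\varepsilon\ge0$ and every solution $(u^\varepsilon,m^\varepsilon)$, $$\|u^\varepsilon\|_{L^\infty(0,T;L^\infty(\mathbb T^d))}\le C+C\,\|g_\varepsilon(m^\varepsilon)\|_{L^a(0,T;L^b(\mathbb T^d))}.$$ -/

import Mathlib

open Set Filter Topology MeasureTheory
open scoped ContDiff ENNReal

noncomputable section

namespace MFG

/-- Euclidean space of dimension `d`. Functions on the torus `𝕋ᵈ = ℝᵈ/ℤᵈ` are represented by
`ℤᵈ`-periodic functions on `Space d`. -/
abbrev Space (d : ℕ) : Type := EuclideanSpace ℝ (Fin d)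

/-- The `i`-th standard basis vector. -/
def basisVec {d : ℕ} (i : Fin d) : Space d := EuclideanSpace.single i (1 : ℝ)

/-- `ℤᵈ`-periodicity: `f` is (the lift of) a function on the torus. -/
def IsPeriodic {d : ℕ} {β : Type*} (f : Space d → β) : Prop :=
  ∀ (x : Space d) (i : Fin d), f (x + basisVec i) = f x

/-- The fundamental cell `[0,1)ᵈ` of the torus. -/
def cell (d : ℕ) : Set (Space d) := {x | ∀ i, x i ∈ Ico (0 : ℝ) 1}

/-- Lebesgue measure on the torus, as Lebesgue measure on the fundamental cell. -/
def torusMeasure (d : ℕ) : Measure (Space d) := volume.restrict (cell d)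

/-- The norm of `f` in `L^a(0,T; L^b(𝕋ᵈ))`, with values in `[0,∞]`. -/
def mixedNorm {d : ℕ} (T : ℝ) (a b : ℝ≥0∞) (f : Space d → ℝ → ℝ) : ℝ≥0∞ :=
  eLpNorm (fun t : ℝ => eLpNorm (fun x => f x t) b (torusMeasure d)) a
    (volume.restrict (Ioo 0 T))

/-- The divergence of a vector field on `ℝᵈ`. -/
def divergence {d : ℕ} (F : Space d → Space d) (x : Space d) : ℝ :=
  ∑ i, fderiv ℝ (fun y => F y i) x (basisVec i)

/-! ### The Hamiltonian and its derivatives -/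

/-- `D_p H(x,p)`. -/
def gradP {d : ℕ} (H : Space d → Space d → ℝ) (x p : Space d) : Space d :=
  gradient (fun q => H x q) p

/-- `D_x H(x,p)`. -/
def gradX {d : ℕ} (H : Space d → Space d → ℝ) (x p : Space d) : Space d :=
  gradient (fun y => H y p) x

/-- The matrix `D²_{xx} H(x,p)`, with entries `∂_{x_i} ∂_{x_j} H`. -/
def hessXX {d : ℕ} (H : Space d → Space d → ℝ) (x p : Space d) : Matrix (Fin d) (Fin d) ℝ :=
  Matrix.of fun i j => fderiv ℝ (fun y => gradX H y p j) x (basisVec i)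

/-- The matrix `D²_{px} H(x,p)`, with entries `∂_{p_i} ∂_{x_j} H`. -/
def hessPX {d : ℕ} (H : Space d → Space d → ℝ) (x p : Space d) : Matrix (Fin d) (Fin d) ℝ :=
  Matrix.of fun i j => fderiv ℝ (fun q => gradX H x q j) p (basisVec i)

/-- The matrix `D²_{pp} H(x,p)`, with entries `∂_{p_i} ∂_{p_j} H`. -/
def hessPP {d : ℕ} (H : Space d → Space d → ℝ) (x p : Space d) : Matrix (Fin d) (Fin d) ℝ :=
  Matrix.of fun i j => fderiv ℝ (fun q => gradP H x q j) p (basisVec i)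

/-- `L̂(x,p) = D_pH(x,p)·p - H(x,p)`. -/
def lagrangianHat {d : ℕ} (H : Space d → Space d → ℝ) (x p : Space d) : ℝ :=
  inner ℝ (gradP H x p) p - H x p

/-! ### Standing assumptions -/

/-- Basic assumptions on the Hamiltonian `H : 𝕋ᵈ × ℝᵈ → ℝ`: it is smooth, strictly convex and
coercive (superlinear) in `p`, and at least `1`. -/
structure IsHamiltonian {d : ℕ} (H : Space d → Space d → ℝ) : Prop where
  periodic : ∀ p, IsPeriodic (fun x => H x p)
  smooth : ContDiff ℝ ∞ (fun z : Space d × Space d => H z.1 z.2)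
  strictConvex : ∀ x, StrictConvexOn ℝ univ (fun p => H x p)
  coercive : ∀ x, Tendsto (fun p => H x p / ‖p‖) (Bornology.cobounded (Space d)) atTop
  one_le : ∀ x p, 1 ≤ H x p

/-- The terminal and initial data: `u₀, m₀ ∈ C^∞(𝕋ᵈ)`, `m₀ ≥ 0` and `∫ m₀ = 1`. -/
structure IsInitialTerminalData {d : ℕ} (u₀ m₀ : Space d → ℝ) : Prop where
  periodic_u : IsPeriodic u₀
  smooth_u : ContDiff ℝ ∞ u₀
  periodic_m : IsPeriodic m₀
  smooth_m : ContDiff ℝ ∞ m₀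
  nonneg_m : ∀ x, 0 ≤ m₀ x
  mass_m : ∫ x, m₀ x ∂(torusMeasure d) = 1

/-- `g : ℝ₀⁺ → ℝ` is non-negative and increasing. Only the values of `g` on `[0,∞)` matter. -/
def IsCoupling (g : ℝ → ℝ) : Prop :=
  (∀ z, 0 ≤ z → 0 ≤ g z) ∧ MonotoneOn g (Ici 0)

/-- `L̂ ≥ c H - C` for some `c, C > 0`. -/
def LagrangianLowerBound {d : ℕ} (H : Space d → Space d → ℝ) : Prop :=
  ∃ c > 0, ∃ C > 0, ∀ x p, c * H x p - C ≤ lagrangianHat H x p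

/-- `g` is the power nonlinearity `g(z) = z^α` on `[0,∞)` for some `α > 0`. -/
def IsPowerCoupling (g : ℝ → ℝ) : Prop :=
  ∃ α : ℝ, 0 < α ∧ ∀ z, 0 ≤ z → g z = z ^ α

/-- `|D_xH|, |D²_{xx}H| ≤ C H + C`, and for every `δ > 0` there is `C_δ` such that
`Tr(D²_{px}H M) ≤ δ Tr(D²_{pp}H M²) + C_δ H` for all symmetric matrices `M`. (The first bound on
the Hessian is written entrywise, which is the same up to the constant.) -/
structure HamiltonianDerivBounds {d : ℕ} (H : Space d → Space d → ℝ) : Prop where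
  dx : ∃ C, ∀ x p, ‖gradX H x p‖ ≤ C * H x p + C
  dxx : ∃ C, ∀ x p i j, |hessXX H x p i j| ≤ C * H x p + C
  dpx : ∀ δ > 0, ∃ C, ∀ (x p : Space d) (M : Matrix (Fin d) (Fin d) ℝ), M.IsSymm →
    (hessPX H x p * M).trace ≤ δ * (hessPP H x p * M ^ 2).trace + C * H x p

/-- `m₀ ≥ κ₀` for some `κ₀ > 0`. -/
def IsBoundedBelow {d : ℕ} (m₀ : Space d → ℝ) : Prop :=
  ∃ κ₀ > 0, ∀ x, κ₀ ≤ m₀ x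

/-- `H(x,p) ≤ C|p|^γ + C` for some `1 + 1/(d+1) < γ < 2`. -/
def SubquadraticGrowth {d : ℕ} (H : Space d → Space d → ℝ) : Prop :=
  ∃ γ : ℝ, 1 + 1 / ((d : ℝ) + 1) < γ ∧ γ < 2 ∧ ∃ C, ∀ x p, H x p ≤ C * ‖p‖ ^ γ + C

/-! ### The regularized system -/

/-- A mollifying kernel on `ℝᵈ`: smooth, compactly supported, non-negative, symmetric, of unit
mass. -/
structure IsMollifier {d : ℕ} (η : Space d → ℝ) : Prop where
  smooth : ContDiff ℝ ∞ η
  compactSupport : HasCompactSupport η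
  nonneg : ∀ z, 0 ≤ η z
  symmetric : ∀ z, η (-z) = η z
  mass : ∫ z, η z = 1

/-- The convolution `η_ε * f`, where `η_ε(z) = ε⁻ᵈ η(z/ε)`, with the convention that `η_0 * f = f`.
For a periodic `f`, this is the convolution on the torus with the periodization of `η_ε`. -/
def mollify {d : ℕ} (η : Space d → ℝ) (ε : ℝ) (f : Space d → ℝ) (x : Space d) : ℝ :=
  if ε = 0 then f x else ∫ y, (ε ^ d)⁻¹ * η (ε⁻¹ • (x - y)) * f y

/-- The regularized coupling `g_ε(m) = η_ε * g(η_ε * m)` (convolutions in `x`); `g_0(m) = g(m)`. -/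
def regCoupling {d : ℕ} (η : Space d → ℝ) (g : ℝ → ℝ) (ε : ℝ) (m : Space d → ℝ → ℝ)
    (x : Space d) (t : ℝ) : ℝ :=
  mollify η ε (fun y => g (mollify η ε (fun z => m z t) y)) x

/-- `f` is a continuous function on `𝕋ᵈ × [0,T]` whose derivatives `f_t`, `D_x f`, `D²_{xx} f` exist
and are continuous on `𝕋ᵈ × (0,T)`. -/
structure IsClassical {d : ℕ} (T : ℝ) (f : Space d → ℝ → ℝ) : Prop where
  periodic : ∀ t ∈ Icc 0 T, IsPeriodic (fun x => f x t)
  continuousOn : ContinuousOn (fun z : Space d × ℝ => f z.1 z.2) (univ ×ˢ Icc 0 T)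
  contDiff_space : ∀ t ∈ Ioo 0 T, ContDiff ℝ 2 (fun x => f x t)
  differentiable_time : ∀ x, ∀ t ∈ Ioo 0 T, DifferentiableAt ℝ (fun s => f x s) t
  continuousOn_dt :
    ContinuousOn (fun z : Space d × ℝ => deriv (fun s => f z.1 s) z.2) (univ ×ˢ Ioo 0 T)
  continuousOn_dx :
    ContinuousOn (fun z : Space d × ℝ => fderiv ℝ (fun x => f x z.2) z.1) (univ ×ˢ Ioo 0 T)
  continuousOn_dxx :
    ContinuousOn (fun z : Space d × ℝ => iteratedFDeriv ℝ 2 (fun x => f x z.2) z.1)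
      (univ ×ˢ Ioo 0 T)

/-- `(u,m)` is a classical solution, with `m ≥ 0`, of the regularized mean-field game system
`-u_t + H(x,Du) = Δu + g_ε(m)`, `m_t - div(D_pH(x,Du) m) = Δm` on `𝕋ᵈ × (0,T)`, with
`u(x,T) = u₀(x)` and `m(x,0) = m₀(x)`. -/
structure IsSolution {d : ℕ} (T : ℝ) (H : Space d → Space d → ℝ) (g : ℝ → ℝ)
    (u₀ m₀ η : Space d → ℝ) (ε : ℝ) (u m : Space d → ℝ → ℝ) : Prop where
  classical_u : IsClassical T u
  classical_m : IsClassical T m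
  nonneg_m : ∀ x, ∀ t ∈ Icc 0 T, 0 ≤ m x t
  hamiltonJacobi : ∀ x, ∀ t ∈ Ioo 0 T,
    -deriv (fun s => u x s) t + H x (gradient (fun y => u y t) x)
      = Laplacian.laplacian (fun y => u y t) x + regCoupling η g ε m x t
  fokkerPlanck : ∀ x, ∀ t ∈ Ioo 0 T,
    deriv (fun s => m x s) t
        - divergence (fun y => m y t • gradP H y (gradient (fun z => u z t) y)) x
      = Laplacian.laplacian (fun y => m y t) x
  terminal : ∀ x, u x T = u₀ x
  initial : ∀ x, m x 0 = m₀ x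

end MFG

end

/-!
The bound is two-sided, and each side uses the Hamilton–Jacobi equation alone. Write
`f = g_ε(m) ≥ 0`.

*Lower bound.* Where `Du = 0` the equation gives `u_t + Δu = H(x,0) - f ≤ max H(·,0)`, so the
minimum principle on the torus (`IsClassical.le_of_critical`) bounds `u` from below by the terminal
datum and `max H(·,0)`, independently of `f`.

*Upper bound.* Since `H ≥ 0`, `u` is a subsolution of the backward heat equation with source `f`:
`-u_t - Δu ≤ f`. With `γ` the standard Gaussian measure on `ℝᵈ`, the function
`φ(τ) = ∫ u(x₀ + √(2τ) z, t₀ + τ) dγ(z)` equals `u(x₀,t₀)` at `τ = 0`, is at most `max u₀` at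
`τ = T - t₀`, and satisfies
`-φ'(τ) = -∫ (u_t + Δu)(x₀ + √(2τ) z, t₀ + τ) dγ(z) ≤ ∫ f(x₀ + √(2τ) z, t₀ + τ) dγ(z)`
(`IsClassical.hasDerivAt_gaussAverage`, where the Laplacian comes from Gaussian integration by
parts). Jensen's inequality and the smoothing estimate `exists_lintegral_gauss_le` bound the
right-hand side by `C τ^{-d/(2b)} ‖f(t₀ + τ)‖_{L^b}`. Hölder's inequality in time then finishes,
because `τ^{-d/(2b)}` lies in `L^{a'}(0,T)` exactly when `d/2 < b/a' = b(a-1)/a`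
(`lintegral_heat_factor_lt_top`, `exists_subsolution_bound`).

The smoothing estimate on the torus does not use the periodic heat kernel: after rescaling, the
Gaussian at scale `σ` is dominated pointwise by the one at the largest scale `√(2T)`, at the cost
of the factor `σ⁻ᵈ`, and the lattice sums of a fixed Gaussian are bounded.
-/

namespace MFG

noncomputable section

variable {d : ℕ}

/-! ### Periodic functions and the fundamental cell -/

/-- The lattice `ℤᵈ`. -/
abbrev lattice (d : ℕ) : AddSubgroup (Space d) :=
  (Submodule.span ℤ (range (EuclideanSpace.basisFun (Fin d) ℝ).toBasis)).toAddSubgroup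

theorem cell_eq_fundamentalDomain :
    cell d = ZSpan.fundamentalDomain (EuclideanSpace.basisFun (Fin d) ℝ).toBasis := by
  ext x
  simp [cell, ZSpan.mem_fundamentalDomain]

instance : Countable (lattice d) :=
  inferInstanceAs
    (Countable (Submodule.span ℤ (range (EuclideanSpace.basisFun (Fin d) ℝ).toBasis)))

theorem isAddFundamentalDomain_cell : IsAddFundamentalDomain (lattice d) (cell d) volume := by
  rw [cell_eq_fundamentalDomain]
  exact ZSpan.isAddFundamentalDomain' _ _

theorem volume_cell : volume (cell d) = 1 := by
  rw [cell_eq_fundamentalDomain,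
    measure_congr (ZSpan.fundamentalDomain_ae_parallelepiped _ volume)]
  simpa using (EuclideanSpace.basisFun (Fin d) ℝ).volume_parallelepiped

instance : IsProbabilityMeasure (torusMeasure d) :=
  ⟨by rw [torusMeasure, Measure.restrict_apply_univ, volume_cell]⟩

theorem IsPeriodic.add_lattice {β : Type*} {f : Space d → β} (hf : IsPeriodic f)
    (k : lattice d) (x : Space d) :
    f ((k : Space d) + x) = f x := by
  obtain ⟨k, hk⟩ := k
  change f (k + x) = f x
  induction hk using Submodule.span_induction generalizing x with
  | mem y hy =>
    obtain ⟨i, rfl⟩ := hy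
    have := hf x i
    simpa [basisVec, add_comm] using this
  | zero => simp
  | add y z _ _ hy hz => rw [add_assoc, hy, hz]
  | smul n y _ hy =>
    induction n using Int.induction_on generalizing x with
    | zero => simp
    | succ n ih => rw [add_smul, one_smul, add_assoc, ih, hy]
    | pred n ih =>
      rw [← hy (((-(n : ℤ) - 1) • y) + x)]
      rw [show y + (((-(n : ℤ) - 1) • y) + x) = (-(n : ℤ)) • y + x by
        rw [sub_smul, one_smul]; abel]
      exact ih x

theorem IsPeriodic.exists_mem_cell {β : Type*} {f : Space d → β} (hf : IsPeriodic f)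
    (x : Space d) : ∃ y ∈ cell d, f y = f x := by
  refine ⟨ZSpan.fract (EuclideanSpace.basisFun (Fin d) ℝ).toBasis x, ?_, ?_⟩
  · rw [cell_eq_fundamentalDomain]
    exact ZSpan.fract_mem_fundamentalDomain _ x
  · rw [ZSpan.fract_apply, sub_eq_neg_add]
    exact hf.add_lattice
      (-ZSpan.floor (EuclideanSpace.basisFun (Fin d) ℝ).toBasis x) x

theorem norm_sub_sq_le_of_mem_cell {x y : Space d} (hx : x ∈ cell d) (hy : y ∈ cell d) :
    ‖x - y‖ ^ 2 ≤ d := by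
  rw [EuclideanSpace.real_norm_sq_eq]
  calc ∑ i, (x - y) i ^ 2 ≤ ∑ _i : Fin d, (1 : ℝ) := by
        refine Finset.sum_le_sum fun i _ => ?_
        have h1 := hx i
        have h2 := hy i
        simp only [PiLp.sub_apply, mem_Ico] at *
        nlinarith
    _ = d := by simp

/-- Unfolding an integral over `ℝᵈ` against a periodic function onto the fundamental cell. -/
theorem IsPeriodic.lintegral_mul_eq {h : Space d → ℝ≥0∞} (hh : IsPeriodic h)
    (hm : Measurable h) {F : Space d → ℝ≥0∞} (hF : Measurable F) :
    ∫⁻ y, h y * F y = ∫⁻ y in cell d, h y *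
      ∑' k : lattice d,
        F ((k : Space d) + y) := by
  rw [isAddFundamentalDomain_cell.lintegral_eq_tsum'']
  simp_rw [← ENNReal.tsum_mul_left]
  rw [lintegral_tsum]
  · refine tsum_congr fun k => lintegral_congr fun y => ?_
    rw [AddSubgroup.vadd_def, vadd_eq_add, hh.add_lattice]
  · intro k
    exact (hm.mul (hF.comp (measurable_const_add _))).aemeasurable

theorem lintegral_exp_neg_mul_norm_sub_sq {l : ℝ} (hl : 0 < l) (x : Space d) :
    ∫⁻ y : Space d, ENNReal.ofReal (Real.exp (-l * ‖y - x‖ ^ 2)) =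
      ENNReal.ofReal ((Real.pi / l) ^ ((d : ℝ) / 2)) := by
  rw [lintegral_sub_right_eq_self (fun y => ENNReal.ofReal (Real.exp (-l * ‖y‖ ^ 2))) x]
  have h := GaussianFourier.integral_rexp_neg_mul_sq_norm (V := Space d) hl
  rw [finrank_euclideanSpace_fin] at h
  rw [← h, ofReal_integral_eq_lintegral_ofReal]
  · by_contra hc
    rw [integral_undef hc] at h
    have : 0 < (Real.pi / l) ^ ((d : ℝ) / 2) := by positivity
    linarith
  · exact ae_of_all _ fun _ => (Real.exp_pos _).le

/-- Lattice sums of a Gaussian are bounded uniformly in its centre: on the cell, each term is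
compared with the integral of a Gaussian of twice the variance over the same translated cell. -/
theorem tsum_gaussian_le {l : ℝ} (hl : 0 < l) (x : Space d) {y : Space d} (hy : y ∈ cell d) :
    ∑' k : lattice d,
        ENNReal.ofReal (Real.exp (-l * ‖(k : Space d) + y - x‖ ^ 2)) ≤
      ENNReal.ofReal (Real.exp (l * d)) * ENNReal.ofReal ((Real.pi / (l / 2)) ^ ((d : ℝ) / 2)) := by
  rw [← lintegral_exp_neg_mul_norm_sub_sq (half_pos hl) x,
    isAddFundamentalDomain_cell.lintegral_eq_tsum'', ← ENNReal.tsum_mul_left]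
  refine ENNReal.tsum_le_tsum fun k => ?_
  rw [← lintegral_const_mul _ (by fun_prop)]
  calc _ = ∫⁻ _z in cell d, ENNReal.ofReal (Real.exp (-l * ‖(k : Space d) + y - x‖ ^ 2)) := by
        rw [setLIntegral_const, volume_cell, mul_one]
    _ ≤ _ := by
      refine setLIntegral_mono (by fun_prop) fun z hz => ?_
      rw [← ENNReal.ofReal_mul (Real.exp_pos _).le, ← Real.exp_add]
      refine ENNReal.ofReal_le_ofReal (Real.exp_le_exp.2 ?_)
      have h1 := norm_sub_sq_le_of_mem_cell hz hy
      have h2 : ‖(k : Space d) + z - x‖ ≤ ‖(k : Space d) + y - x‖ + ‖z - y‖ := by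
        refine le_trans (le_of_eq ?_) (norm_add_le _ _)
        congr 1; abel
      have h3 : ‖(k : Space d) + z - x‖ ^ 2 ≤ 2 * ‖(k : Space d) + y - x‖ ^ 2 + 2 * d := by
        nlinarith [norm_nonneg ((k : Space d) + z - x),
          sq_nonneg (‖(k : Space d) + y - x‖ - ‖z - y‖)]
      rw [AddSubgroup.vadd_def, vadd_eq_add]
      nlinarith

theorem IsPeriodic.lintegral_mul_gaussian_le {h : Space d → ℝ≥0∞} (hh : IsPeriodic h)
    (hm : Measurable h) {l : ℝ} (hl : 0 < l) (x : Space d) :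
    ∫⁻ y, h y * ENNReal.ofReal (Real.exp (-l * ‖y - x‖ ^ 2)) ≤
      (∫⁻ y in cell d, h y) * (ENNReal.ofReal (Real.exp (l * d)) *
        ENNReal.ofReal ((Real.pi / (l / 2)) ^ ((d : ℝ) / 2))) := by
  rw [hh.lintegral_mul_eq hm (by fun_prop), ← lintegral_mul_const _ hm]
  refine setLIntegral_mono (hm.mul_const _) fun y hy => ?_
  exact mul_le_mul_right (tsum_gaussian_le hl x hy) _

/-! ### The standard Gaussian measure -/

/-- The density of the standard Gaussian on `ℝᵈ`. -/
def gaussDensity (z : Space d) : ℝ :=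
  ((2 * Real.pi) ^ ((d : ℝ) / 2))⁻¹ * Real.exp (-(1 / 2) * ‖z‖ ^ 2)

/-- The standard Gaussian measure on `ℝᵈ`, given by its density. -/
def gauss (d : ℕ) : Measure (Space d) :=
  volume.withDensity fun z => ENNReal.ofReal (gaussDensity z)

theorem gaussDensity_pos (z : Space d) : 0 < gaussDensity z := by
  unfold gaussDensity; positivity

theorem contDiff_gaussDensity : ContDiff ℝ ∞ (gaussDensity (d := d)) := by
  unfold gaussDensity
  exact contDiff_const.mul (Real.contDiff_exp.comp (contDiff_const.mul (contDiff_norm_sq ℝ)))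

theorem continuous_gaussDensity : Continuous (gaussDensity (d := d)) :=
  contDiff_gaussDensity.continuous

theorem fderiv_gaussDensity (z v : Space d) :
    fderiv ℝ gaussDensity z v = -(inner ℝ z v * gaussDensity z) := by
  have h := (((hasStrictFDerivAt_norm_sq z).hasFDerivAt.const_mul (-(1 / 2) : ℝ)).exp).const_mul
    ((2 * Real.pi) ^ ((d : ℝ) / 2))⁻¹
  have h2 : HasFDerivAt (gaussDensity (d := d)) _ z := h
  rw [h2.fderiv]
  simp [gaussDensity]
  ring

instance : IsProbabilityMeasure (gauss d) := by
  refine ⟨?_⟩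
  rw [gauss, withDensity_apply _ MeasurableSet.univ, Measure.restrict_univ]
  have h := lintegral_exp_neg_mul_norm_sub_sq (d := d) (l := 1 / 2) (by norm_num) 0
  simp only [sub_zero] at h
  have hp : 0 < (2 * Real.pi) ^ ((d : ℝ) / 2) := by positivity
  simp_rw [gaussDensity, ENNReal.ofReal_mul (inv_pos.2 hp).le]
  rw [lintegral_const_mul _ (by fun_prop), h, ← ENNReal.ofReal_mul (inv_pos.2 hp).le,
    show Real.pi / (1 / 2) = 2 * Real.pi by ring, inv_mul_cancel₀ hp.ne', ENNReal.ofReal_one]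

theorem integral_gauss (f : Space d → ℝ) :
    ∫ z, f z ∂(gauss d) = ∫ z, f z * gaussDensity z := by
  rw [gauss, integral_withDensity_eq_integral_toReal_smul
    (continuous_gaussDensity.measurable.ennreal_ofReal) (ae_of_all _ fun _ => ENNReal.ofReal_lt_top)]
  refine integral_congr_ae (ae_of_all _ fun z => ?_)
  simp [ENNReal.toReal_ofReal (gaussDensity_pos z).le, mul_comm]

theorem integrable_gauss_iff (f : Space d → ℝ) :
    Integrable f (gauss d) ↔ Integrable (fun z => f z * gaussDensity z) := by
  rw [gauss, integrable_withDensity_iff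
    (continuous_gaussDensity.measurable.ennreal_ofReal) (ae_of_all _ fun _ => ENNReal.ofReal_lt_top)]
  simp only [ENNReal.toReal_ofReal (gaussDensity_pos _).le]

theorem integrable_norm_gauss : Integrable (fun z : Space d => ‖z‖) (gauss d) := by
  have h0 : Integrable (fun z : Space d => Real.exp (-(1 / 4) * ‖z‖ ^ 2)) := by
    have h := GaussianFourier.integral_rexp_neg_mul_sq_norm (V := Space d)
      (b := 1 / 4) (by norm_num)
    by_contra hc
    rw [integral_undef hc] at h
    have : 0 < (Real.pi / (1 / 4)) ^ ((Module.finrank ℝ (Space d) : ℝ) / 2) := by positivity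
    linarith
  rw [integrable_gauss_iff]
  refine (h0.const_mul (((2 * Real.pi) ^ ((d : ℝ) / 2))⁻¹ * 2)).mono'
    ((by fun_prop : Continuous fun z : Space d => ‖z‖).mul
      continuous_gaussDensity).aestronglyMeasurable (ae_of_all _ fun z => ?_)
  have hz : ‖z‖ ≤ 2 * Real.exp (1 / 4 * ‖z‖ ^ 2) := by
    have := Real.add_one_le_exp (1 / 4 * ‖z‖ ^ 2)
    nlinarith [sq_nonneg (‖z‖ - 1)]
  have hp : 0 < ((2 * Real.pi) ^ ((d : ℝ) / 2))⁻¹ := by positivity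
  rw [Real.norm_of_nonneg (mul_nonneg (norm_nonneg _) (gaussDensity_pos z).le), gaussDensity]
  calc ‖z‖ * (((2 * Real.pi) ^ ((d : ℝ) / 2))⁻¹ * Real.exp (-(1 / 2) * ‖z‖ ^ 2))
      ≤ (2 * Real.exp (1 / 4 * ‖z‖ ^ 2)) *
        (((2 * Real.pi) ^ ((d : ℝ) / 2))⁻¹ * Real.exp (-(1 / 2) * ‖z‖ ^ 2)) := by gcongr
    _ = ((2 * Real.pi) ^ ((d : ℝ) / 2))⁻¹ * 2 *
        (Real.exp (1 / 4 * ‖z‖ ^ 2) * Real.exp (-(1 / 2) * ‖z‖ ^ 2)) := by ring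
    _ = _ := by rw [← Real.exp_add]; ring_nf

theorem integrable_gauss_of_bounded {f : Space d → ℝ} (hf : Continuous f) {C : ℝ}
    (hC : ∀ z, ‖f z‖ ≤ C) : Integrable f (gauss d) :=
  (integrable_const C).mono' hf.aestronglyMeasurable (ae_of_all _ hC)

theorem integrable_inner_mul_gauss {f : Space d → ℝ} (hf : Continuous f) {C : ℝ}
    (hC : ∀ z, ‖f z‖ ≤ C) (v : Space d) :
    Integrable (fun z => inner ℝ z v * f z) (gauss d) := by
  refine (integrable_norm_gauss.mul_const (‖v‖ * C)).mono' (by fun_prop)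
    (ae_of_all _ fun z => ?_)
  rw [norm_mul, ← mul_assoc]
  exact mul_le_mul (norm_inner_le_norm z v) (hC z) (norm_nonneg _) (by positivity)

/-- Gaussian integration by parts (Stein's identity). -/
theorem integral_inner_mul_gauss {f : Space d → ℝ} (hf : ContDiff ℝ 1 f) (v : Space d) {C : ℝ}
    (hC : ∀ z, ‖f z‖ ≤ C) (hC' : ∀ z, ‖fderiv ℝ f z v‖ ≤ C) :
    ∫ z, inner ℝ z v * f z ∂(gauss d) = ∫ z, fderiv ℝ f z v ∂(gauss d) := by
  have hcd : Continuous fun z => fderiv ℝ f z v :=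
    (hf.continuous_fderiv one_ne_zero).clm_apply continuous_const
  rw [integral_gauss, integral_gauss]
  have key := integral_mul_fderiv_eq_neg_fderiv_mul_of_integrable (μ := volume)
    (f := f) (g := gaussDensity (d := d)) (v := v)
    ((integrable_gauss_iff _).1 (integrable_gauss_of_bounded hcd hC')) ?_
    ((integrable_gauss_iff _).1 (integrable_gauss_of_bounded hf.continuous hC))
    (fun x _ => hf.differentiable one_ne_zero x)
    (fun x _ => (contDiff_gaussDensity.differentiable (by simp)) x)
  · rw [← neg_inj, ← key, ← integral_neg]
    refine integral_congr_ae (ae_of_all _ fun z => ?_)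
    simp only [fderiv_gaussDensity]
    ring
  · refine ((integrable_gauss_iff _).1
      (integrable_inner_mul_gauss hf.continuous hC v)).neg.congr (ae_of_all _ fun z => ?_)
    simp only [fderiv_gaussDensity, Pi.neg_apply]
    ring

/-- Gaussian averages at scale `σ` of a non-negative periodic function are controlled by its
integral over the cell, with the factor `σ⁻ᵈ` of the heat kernel. For `σ ≤ S`, the Gaussian of
variance `σ²` is, up to normalization, below the one of variance `S²`, so that a single fixed scale
has to be unfolded. -/
theorem exists_lintegral_gauss_le (d : ℕ) {S : ℝ} (hS : 0 < S) :
    ∃ K : ℝ, 0 < K ∧ ∀ h : Space d → ℝ≥0∞, IsPeriodic h → Measurable h →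
      ∀ σ : ℝ, 0 < σ → σ ≤ S → ∀ x : Space d,
        ∫⁻ z, h (x + σ • z) ∂(gauss d) ≤
          ENNReal.ofReal (K * (σ ^ d)⁻¹) * ∫⁻ y in cell d, h y := by
  have hl : 0 < 1 / (2 * S ^ 2) := by positivity
  set l := 1 / (2 * S ^ 2) with hldef
  set c : ℝ := ((2 * Real.pi) ^ ((d : ℝ) / 2))⁻¹ with hc
  have hcpos : 0 < c := by positivity
  refine ⟨c * (Real.exp (l * d) * (Real.pi / (l / 2)) ^ ((d : ℝ) / 2)), by positivity, ?_⟩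
  intro h hh hm σ hσ hσS x
  set G : Space d → ℝ≥0∞ := fun y => ENNReal.ofReal (gaussDensity (σ⁻¹ • y)) * h (x + y) with hG
  have hGm : Measurable G :=
    (continuous_gaussDensity.comp (continuous_const_smul _)).measurable.ennreal_ofReal.mul
      (hm.comp (measurable_const_add x))
  have h1 : ∫⁻ z, h (x + σ • z) ∂(gauss d) = ENNReal.ofReal ((σ ^ d)⁻¹) * ∫⁻ y, G y := by
    rw [gauss, lintegral_withDensity_eq_lintegral_mul _
      continuous_gaussDensity.measurable.ennreal_ofReal (by fun_prop)]
    have h2 : ∫⁻ z, G (σ • z) = ENNReal.ofReal ((σ ^ d)⁻¹) * ∫⁻ y, G y := by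
      rw [← lintegral_map (f := G) hGm (measurable_const_smul σ),
        Measure.map_addHaar_smul _ hσ.ne', lintegral_smul_measure, finrank_euclideanSpace_fin,
        abs_of_pos (by positivity), smul_eq_mul]
    rw [← h2]
    refine lintegral_congr fun z => ?_
    simp [hG, smul_smul, inv_mul_cancel₀ hσ.ne']
  have h3 : ∫⁻ y, G y ≤ ENNReal.ofReal c * ((∫⁻ y in cell d, h y) *
      (ENNReal.ofReal (Real.exp (l * d)) *
        ENNReal.ofReal ((Real.pi / (l / 2)) ^ ((d : ℝ) / 2)))) := by
    calc ∫⁻ y, G y ≤ ∫⁻ y, ENNReal.ofReal c * (h (x + y) *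
          ENNReal.ofReal (Real.exp (-l * ‖(x + y) - x‖ ^ 2))) := by
          refine lintegral_mono fun y => ?_
          simp only [hG]
          rw [mul_left_comm, ← ENNReal.ofReal_mul hcpos.le, mul_comm]
          gcongr
          rw [gaussDensity, norm_smul, norm_inv, Real.norm_of_nonneg hσ.le, add_sub_cancel_left,
            ← hc, hldef]
          gcongr c * Real.exp ?_
          have h4 : 1 / S ^ 2 ≤ 1 / σ ^ 2 := by gcongr
          have h5 := mul_le_mul_of_nonneg_right h4 (sq_nonneg ‖y‖)
          calc -(1 / 2) * (σ⁻¹ * ‖y‖) ^ 2 = -(1 / 2) * (1 / σ ^ 2 * ‖y‖ ^ 2) := by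
                field_simp
            _ ≤ -(1 / 2) * (1 / S ^ 2 * ‖y‖ ^ 2) := by linarith
            _ = _ := by field_simp
      _ = ENNReal.ofReal c * ∫⁻ y, h y * ENNReal.ofReal (Real.exp (-l * ‖y - x‖ ^ 2)) := by
          rw [lintegral_const_mul _ (by fun_prop)]
          rw [lintegral_add_left_eq_self
            (fun y => h y * ENNReal.ofReal (Real.exp (-l * ‖y - x‖ ^ 2))) x]
      _ ≤ _ := mul_le_mul_right (hh.lintegral_mul_gaussian_le hm hl x) _
  rw [h1]
  refine (mul_le_mul_right h3 _).trans (le_of_eq ?_)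
  rw [ENNReal.ofReal_mul (by positivity), ENNReal.ofReal_mul (by positivity),
    ENNReal.ofReal_mul (by positivity)]
  ring

/-! ### Differentiating Gaussian averages in space -/

theorem isCompact_closure_cell : IsCompact (closure (cell d)) := by
  rw [cell_eq_fundamentalDomain]
  exact (ZSpan.fundamentalDomain_isBounded _).isCompact_closure

/-- Periodic functions that are continuous on a closed time slab are bounded there. -/
theorem exists_bound_of_periodic {E : Type*} [NormedAddCommGroup E] {F : Space d → ℝ → E}
    {s₁ s₂ : ℝ} (hp : ∀ t ∈ Icc s₁ s₂, IsPeriodic fun x => F x t)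
    (hc : ContinuousOn (fun z : Space d × ℝ => F z.1 z.2) (univ ×ˢ Icc s₁ s₂)) :
    ∃ C, ∀ x, ∀ t ∈ Icc s₁ s₂, ‖F x t‖ ≤ C := by
  obtain ⟨C, hC⟩ := (isCompact_closure_cell (d := d)).prod (isCompact_Icc (a := s₁) (b := s₂))
    |>.exists_bound_of_continuousOn (hc.mono (prod_mono_left (subset_univ _)))
  refine ⟨C, fun x t ht => ?_⟩
  obtain ⟨y, hy, hyx⟩ := (hp t ht).exists_mem_cell x
  rw [← hyx]
  exact hC (y, t) ⟨subset_closure hy, ht⟩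

theorem IsPeriodic.exists_bound {E : Type*} [NormedAddCommGroup E] {f : Space d → E}
    (hf : IsPeriodic f) (hc : Continuous f) : ∃ C, ∀ x, ‖f x‖ ≤ C := by
  obtain ⟨C, hC⟩ := (isCompact_closure_cell (d := d)).exists_bound_of_continuousOn hc.continuousOn
  refine ⟨C, fun x => ?_⟩
  obtain ⟨y, hy, hyx⟩ := hf.exists_mem_cell x
  rw [← hyx]
  exact hC y (subset_closure hy)

theorem IsPeriodic.fderiv {E : Type*} [NormedAddCommGroup E] [NormedSpace ℝ E] {f : Space d → E}
    (hf : IsPeriodic f) : IsPeriodic (fderiv ℝ f) := by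
  intro x i
  rw [← fderiv_comp_add_right]
  congr 1
  exact funext fun y => hf y i

theorem laplacian_eq_sum (v : Space d → ℝ) (x : Space d) :
    Laplacian.laplacian v x =
      ∑ i, fderiv ℝ (fderiv ℝ v) x (basisVec i) (basisVec i) := by
  have := congrFun (InnerProductSpace.laplacian_eq_iteratedFDeriv_orthonormalBasis v
    (EuclideanSpace.basisFun (Fin d) ℝ)) x
  simpa [iteratedFDeriv_two_apply, basisVec] using! this

theorem norm_basisVec (i : Fin d) : ‖(basisVec i : Space d)‖ = 1 := by
  simp [basisVec]

theorem eq_sum_inner_basisVec (z : Space d) : z = ∑ i, inner ℝ z (basisVec i) • basisVec i := by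
  have := (EuclideanSpace.basisFun (Fin d) ℝ).sum_repr' z
  simpa [basisVec, real_inner_comm] using! this.symm

theorem clm_apply_eq_sum (L : Space d →L[ℝ] ℝ) (z : Space d) :
    L z = ∑ i, inner ℝ z (basisVec i) * L (basisVec i) := by
  conv_lhs => rw [eq_sum_inner_basisVec z]
  simp only [map_smul, map_sum, smul_eq_mul]

theorem continuous_laplacian {v : Space d → ℝ} (hv : ContDiff ℝ 2 v) :
    Continuous fun x => Laplacian.laplacian v x := by
  simp_rw [laplacian_eq_sum]
  have h : Continuous (fderiv ℝ (fderiv ℝ v)) :=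
    (hv.fderiv_right (m := 1) (by norm_num)).continuous_fderiv one_ne_zero
  fun_prop

theorem fderiv_fderiv_comp_affine {v : Space d → ℝ} (hv : ContDiff ℝ 1 (fderiv ℝ v))
    (x : Space d) (σ : ℝ) (z e : Space d) :
    fderiv ℝ (fun z => fderiv ℝ v (x + σ • z) e) z e =
      σ * fderiv ℝ (fderiv ℝ v) (x + σ • z) e e := by
  have h1 : HasFDerivAt (fun z : Space d => x + σ • z)
      (σ • ContinuousLinearMap.id ℝ (Space d)) z :=
    ((hasFDerivAt_id z).const_smul σ).const_add x
  have h2 : HasFDerivAt (fderiv ℝ v) (fderiv ℝ (fderiv ℝ v) (x + σ • z)) (x + σ • z) :=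
    (hv.differentiable one_ne_zero _).hasFDerivAt
  have h3 : HasFDerivAt (fun z => fderiv ℝ v (x + σ • z))
      ((fderiv ℝ (fderiv ℝ v) (x + σ • z)).comp (σ • ContinuousLinearMap.id ℝ (Space d))) z :=
    h2.comp z h1
  have h4 : HasFDerivAt (fun z => fderiv ℝ v (x + σ • z) e) _ z :=
    (ContinuousLinearMap.apply ℝ ℝ e).hasFDerivAt.comp z h3
  rw [h4.fderiv]
  simp

/-- Gaussian integration by parts for one partial derivative of `z ↦ v(x + σz)`, with the
integrability needed to sum over the coordinates. -/
theorem integral_inner_mul_fderiv_gauss {v : Space d → ℝ} (hv : ContDiff ℝ 2 v) {C : ℝ}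
    (hC : ∀ x, ‖fderiv ℝ v x‖ ≤ C) (hC' : ∀ x, ‖fderiv ℝ (fderiv ℝ v) x‖ ≤ C)
    (x : Space d) {σ : ℝ} (hσ : 0 < σ) (i : Fin d) :
    Integrable (fun z => inner ℝ z (basisVec i) * fderiv ℝ v (x + σ • z) (basisVec i)) (gauss d) ∧
    Integrable (fun z => fderiv ℝ (fderiv ℝ v) (x + σ • z) (basisVec i) (basisVec i)) (gauss d) ∧
    ∫ z, inner ℝ z (basisVec i) * fderiv ℝ v (x + σ • z) (basisVec i) ∂(gauss d) =
      σ * ∫ z, fderiv ℝ (fderiv ℝ v) (x + σ • z) (basisVec i) (basisVec i) ∂(gauss d) := by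
  have hd1 : ContDiff ℝ 1 (fderiv ℝ v) := hv.fderiv_right (m := 1) (by norm_num)
  have ha : ContDiff ℝ 1 fun z : Space d => x + σ • z := by fun_prop
  have hfc : ContDiff ℝ 1 fun z : Space d => fderiv ℝ v (x + σ • z) (basisVec i) :=
    (hd1.comp ha).clm_apply contDiff_const
  have hfb : ∀ z : Space d, ‖fderiv ℝ v (x + σ • z) (basisVec i)‖ ≤ C := fun z => by
    have := (fderiv ℝ v (x + σ • z)).le_opNorm (basisVec i)
    rw [norm_basisVec, mul_one] at this
    exact this.trans (hC _)
  have hdd : ∀ y, ‖fderiv ℝ (fderiv ℝ v) y (basisVec i) (basisVec i)‖ ≤ C := fun y => by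
    have h1 := (fderiv ℝ (fderiv ℝ v) y (basisVec i)).le_opNorm (basisVec i)
    have h2 := (fderiv ℝ (fderiv ℝ v) y).le_opNorm (basisVec i)
    rw [norm_basisVec, mul_one] at h1 h2
    exact h1.trans (h2.trans (hC' _))
  have hcc : Continuous fun y => fderiv ℝ (fderiv ℝ v) y (basisVec i) (basisVec i) :=
    ((hd1.continuous_fderiv one_ne_zero).clm_apply continuous_const).clm_apply continuous_const
  have hb : ∀ z : Space d,
      ‖fderiv ℝ (fun z => fderiv ℝ v (x + σ • z) (basisVec i)) z (basisVec i)‖ ≤ max C (σ * C) :=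
    fun z => by
      rw [fderiv_fderiv_comp_affine hd1, norm_mul, Real.norm_of_nonneg hσ.le]
      exact (mul_le_mul_of_nonneg_left (hdd _) hσ.le).trans (le_max_right _ _)
  refine ⟨integrable_inner_mul_gauss hfc.continuous hfb _,
    integrable_gauss_of_bounded (hcc.comp ha.continuous) (fun z => hdd (x + σ • z)), ?_⟩
  rw [integral_inner_mul_gauss hfc (basisVec i) (fun z => (hfb z).trans (le_max_left _ _)) hb,
    ← integral_const_mul]
  exact integral_congr_ae (ae_of_all _ fun z => fderiv_fderiv_comp_affine hd1 x σ z _)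

/-- The derivative of `σ ↦ ∫ v(x + σz) dγ(z)`, divided by `σ`, is the Gaussian average of the
Laplacian. -/
theorem integral_fderiv_gauss {v : Space d → ℝ} (hv : ContDiff ℝ 2 v) {C : ℝ}
    (hC : ∀ x, ‖fderiv ℝ v x‖ ≤ C) (hC' : ∀ x, ‖fderiv ℝ (fderiv ℝ v) x‖ ≤ C)
    (x : Space d) {σ : ℝ} (hσ : 0 < σ) :
    ∫ z, fderiv ℝ v (x + σ • z) (σ⁻¹ • z) ∂(gauss d) =
      ∫ z, Laplacian.laplacian v (x + σ • z) ∂(gauss d) := by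
  have key := integral_inner_mul_fderiv_gauss hv hC hC' x hσ
  have hL : ∀ z : Space d, fderiv ℝ v (x + σ • z) (σ⁻¹ • z) =
      ∑ i, σ⁻¹ * (inner ℝ z (basisVec i) * fderiv ℝ v (x + σ • z) (basisVec i)) := fun z => by
    rw [map_smul, clm_apply_eq_sum _ z, smul_eq_mul, Finset.mul_sum]
  simp_rw [hL, laplacian_eq_sum]
  rw [integral_finsetSum _ fun i _ => (key i).1.const_mul _,
    integral_finsetSum _ fun i _ => (key i).2.1]
  refine Finset.sum_congr rfl fun i _ => ?_
  rw [integral_const_mul, (key i).2.2, ← mul_assoc, inv_mul_cancel₀ hσ.ne', one_mul]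

namespace IsClassical

variable {T : ℝ} {u : Space d → ℝ → ℝ}

theorem periodic_deriv (hu : IsClassical T u) {t : ℝ} (ht : t ∈ Ioo 0 T) :
    IsPeriodic fun x => deriv (fun s => u x s) t := by
  intro x i
  refine Filter.EventuallyEq.deriv_eq ?_
  filter_upwards [Ioo_mem_nhds ht.1 ht.2] with s hs
  exact hu.periodic s (Ioo_subset_Icc_self hs) x i

theorem continuousOn_laplacian (hu : IsClassical T u) :
    ContinuousOn (fun z : Space d × ℝ => Laplacian.laplacian (fun x => u x z.2) z.1)
      (univ ×ˢ Ioo 0 T) := by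
  simp_rw [InnerProductSpace.laplacian_eq_iteratedFDeriv_orthonormalBasis _
    (EuclideanSpace.basisFun (Fin d) ℝ)]
  refine continuousOn_finsetSum _ fun i _ => ?_
  exact (ContinuousMultilinearMap.apply ℝ (fun _ : Fin 2 => Space d) ℝ
    ![_, _]).continuous.comp_continuousOn hu.continuousOn_dxx

theorem hasDerivAt_comp (hu : IsClassical T u) {c : ℝ → Space d} {c' : Space d} {θ : ℝ → ℝ}
    {τ : ℝ} (hc : HasDerivAt c c' τ) (hθ : HasDerivAt θ 1 τ) (hτ : θ τ ∈ Ioo 0 T) :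
    HasDerivAt (fun r => u (c r) (θ r))
      (fderiv ℝ (fun y => u y (θ τ)) (c τ) c' + deriv (fun s => u (c τ) s) (θ τ)) τ := by
  have hopen : IsOpen ((univ : Set (Space d)) ×ˢ Ioo (0 : ℝ) T) := isOpen_univ.prod isOpen_Ioo
  have hmem : (univ : Set (Space d)) ×ˢ Ioo (0 : ℝ) T ∈ 𝓝 (c τ, θ τ) :=
    hopen.mem_nhds ⟨mem_univ _, hτ⟩
  have h := hasStrictFDerivAt_uncurry_coprod (𝕜 := ℝ) (u := (c τ, θ τ)) (f := u)
    (f₁ := fun x t => fderiv ℝ (fun y => u y t) x)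
    (f₂ := fun x t => ContinuousLinearMap.toSpanSingleton ℝ (deriv (fun s => u x s) t))
    (by
      filter_upwards [hmem] with v hv
      exact ((hu.contDiff_space v.2 hv.2).differentiable two_ne_zero v.1).hasFDerivAt)
    (by
      filter_upwards [hmem] with v hv
      exact (hu.differentiable_time v.1 v.2 hv.2).hasDerivAt.hasFDerivAt)
    (hu.continuousOn_dx.continuousAt hmem)
    ((ContinuousLinearMap.toSpanSingletonCLE (𝕜 := ℝ) (E := ℝ)).continuous.continuousAt.comp
      (hu.continuousOn_dt.continuousAt hmem))
  have h2 := h.hasFDerivAt.comp_hasDerivAt τ (hc.prodMk hθ)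
  simpa [Function.HasUncurry.uncurry] using! h2

end IsClassical

/-! ### Gaussian averages of classical functions -/

namespace IsClassical

variable {T : ℝ} {u : Space d → ℝ → ℝ}

theorem exists_bound (hu : IsClassical T u) : ∃ M, ∀ x, ∀ t ∈ Icc 0 T, ‖u x t‖ ≤ M :=
  exists_bound_of_periodic hu.periodic hu.continuousOn

theorem continuous_slice (hu : IsClassical T u) {t : ℝ} (ht : t ∈ Icc 0 T) :
    Continuous fun x => u x t :=
  hu.continuousOn.comp_continuous (f := fun x : Space d => (x, t)) (by fun_prop)
    fun _ => ⟨mem_univ _, ht⟩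

theorem continuous_deriv_slice (hu : IsClassical T u) {t : ℝ} (ht : t ∈ Ioo 0 T) :
    Continuous fun x => deriv (fun s => u x s) t :=
  hu.continuousOn_dt.comp_continuous (f := fun x : Space d => (x, t)) (by fun_prop)
    fun _ => ⟨mem_univ _, ht⟩

theorem continuousOn_gaussAverage (hu : IsClassical T u) {t₀ : ℝ} (ht₀ : 0 ≤ t₀) (x₀ : Space d) :
    ContinuousOn (fun r => ∫ z, u (x₀ + √(2 * r) • z) (t₀ + r) ∂(gauss d))
      (Icc 0 (T - t₀)) := by
  have hmem : ∀ r ∈ Icc 0 (T - t₀), t₀ + r ∈ Icc 0 T := fun r hr =>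
    ⟨by linarith [hr.1], by linarith [hr.2]⟩
  obtain ⟨M, hM⟩ := hu.exists_bound
  refine continuousOn_of_dominated (bound := fun _ => M) ?_ ?_ (integrable_const _) ?_
  · intro r hr
    exact ((hu.continuous_slice (hmem r hr)).comp (by fun_prop)).aestronglyMeasurable
  · exact fun r hr => ae_of_all _ fun z => hM _ _ (hmem r hr)
  · refine ae_of_all _ fun z => ?_
    refine hu.continuousOn.comp (f := fun r : ℝ => (x₀ + √(2 * r) • z, t₀ + r)) ?_
      fun r hr => ⟨mem_univ _, hmem r hr⟩
    exact Continuous.continuousOn (by fun_prop)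

/-- The average of `u(·, t₀ + r)` against the heat kernel at time `r`, written as an integral
against a fixed Gaussian, has derivative the average of `u_t + Δu`. -/
theorem hasDerivAt_gaussAverage (hu : IsClassical T u) {t₀ : ℝ} (ht₀ : 0 < t₀) (x₀ : Space d)
    {τ : ℝ} (hτ : τ ∈ Ioo 0 (T - t₀)) :
    HasDerivAt (fun r => ∫ z, u (x₀ + √(2 * r) • z) (t₀ + r) ∂(gauss d))
      (∫ z, (deriv (fun s => u (x₀ + √(2 * τ) • z) s) (t₀ + τ) +
        Laplacian.laplacian (fun y => u y (t₀ + τ)) (x₀ + √(2 * τ) • z)) ∂(gauss d)) τ := by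
  obtain ⟨hτ0, hτT⟩ := hτ
  -- on the time interval `[t₀, s₂]` the first derivatives of `u` are bounded
  set s₂ : ℝ := t₀ + (τ + (T - t₀)) / 2 with hs₂
  have hsub : Icc t₀ s₂ ⊆ Ioo 0 T := fun s hs =>
    ⟨by linarith [hs.1], by have := hs.2; rw [hs₂] at this; linarith⟩
  obtain ⟨C₁, hC₁⟩ := exists_bound_of_periodic (s₁ := t₀) (s₂ := s₂)
    (F := fun x t => fderiv ℝ (fun y => u y t) x)
    (fun t ht => IsPeriodic.fderiv (hu.periodic t (Ioo_subset_Icc_self (hsub ht))))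
    (hu.continuousOn_dx.mono (prod_mono_right hsub))
  obtain ⟨C₂, hC₂⟩ := exists_bound_of_periodic (s₁ := t₀) (s₂ := s₂)
    (F := fun x t => deriv (fun s => u x s) t)
    (fun t ht => hu.periodic_deriv (hsub ht))
    (hu.continuousOn_dt.mono (prod_mono_right hsub))
  obtain ⟨M, hM⟩ := hu.exists_bound
  set N : Set ℝ := Ioo (τ / 2) ((τ + (T - t₀)) / 2) with hN
  have hNτ : τ ∈ N := ⟨by linarith, by linarith⟩
  have hN0 : ∀ r ∈ N, 0 < r := fun r hr => by linarith [hr.1]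
  have hNs : ∀ r ∈ N, t₀ + r ∈ Icc t₀ s₂ := fun r hr =>
    ⟨by linarith [hN0 r hr], by rw [hs₂]; linarith [hr.2]⟩
  have hC₁0 : 0 ≤ C₁ := (norm_nonneg _).trans (hC₁ 0 _ (hNs τ hNτ))
  have hNN : N ∈ 𝓝 τ := Ioo_mem_nhds hNτ.1 hNτ.2
  have htτ : t₀ + τ ∈ Ioo 0 T := hsub (hNs τ hNτ)
  have hv : ContDiff ℝ 2 fun y => u y (t₀ + τ) := hu.contDiff_space _ htτ
  have hvd : ContDiff ℝ 1 (fderiv ℝ fun y => u y (t₀ + τ)) :=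
    hv.fderiv_right (m := 1) (by norm_num)
  have hper : IsPeriodic fun y => u y (t₀ + τ) := hu.periodic _ (Ioo_subset_Icc_self htτ)
  have ha : Continuous fun z : Space d => x₀ + √(2 * τ) • z := by fun_prop
  have hcF : Continuous fun z : Space d =>
      fderiv ℝ (fun y => u y (t₀ + τ)) (x₀ + √(2 * τ) • z) ((√(2 * τ))⁻¹ • z) :=
    (hvd.continuous.comp ha).clm_apply (by fun_prop)
  have hct : Continuous fun z : Space d => deriv (fun s => u (x₀ + √(2 * τ) • z) s) (t₀ + τ) :=
    (hu.continuous_deriv_slice htτ).comp ha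
  have hbound : ∀ z : Space d, ∀ r ∈ N,
      ‖fderiv ℝ (fun y => u y (t₀ + r)) (x₀ + √(2 * r) • z) ((√(2 * r))⁻¹ • z) +
        deriv (fun s => u (x₀ + √(2 * r) • z) s) (t₀ + r)‖ ≤ C₁ * (√τ)⁻¹ * ‖z‖ + C₂ := by
    intro z r hr
    refine (norm_add_le _ _).trans (add_le_add ?_ (hC₂ _ _ (hNs r hr)))
    refine ((fderiv ℝ (fun y => u y (t₀ + r)) (x₀ + √(2 * r) • z)).le_opNorm _).trans ?_
    rw [norm_smul, norm_inv, Real.norm_of_nonneg (Real.sqrt_nonneg _), ← mul_assoc]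
    have hsq : (√(2 * r))⁻¹ ≤ (√τ)⁻¹ :=
      inv_anti₀ (Real.sqrt_pos.2 hτ0) (Real.sqrt_le_sqrt (by linarith [hr.1]))
    exact mul_le_mul_of_nonneg_right (mul_le_mul (hC₁ _ _ (hNs r hr)) hsq (by positivity) hC₁0)
      (norm_nonneg _)
  have key := hasDerivAt_integral_of_dominated_loc_of_deriv_le (μ := gauss d) (x₀ := τ) (s := N)
    (F := fun r z => u (x₀ + √(2 * r) • z) (t₀ + r))
    (F' := fun r z => fderiv ℝ (fun y => u y (t₀ + r)) (x₀ + √(2 * r) • z) ((√(2 * r))⁻¹ • z) +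
      deriv (fun s => u (x₀ + √(2 * r) • z) s) (t₀ + r))
    (bound := fun z => C₁ * (√τ)⁻¹ * ‖z‖ + C₂) hNN
    (by
      filter_upwards [hNN] with r hr
      exact ((hu.continuous_slice (Ioo_subset_Icc_self (hsub (hNs r hr)))).comp
        (by fun_prop)).aestronglyMeasurable)
    (integrable_gauss_of_bounded (hv.continuous.comp ha)
      fun z => hM _ _ (Ioo_subset_Icc_self htτ))
    (hcF.add hct).aestronglyMeasurable
    (ae_of_all _ hbound)
    ((integrable_norm_gauss.const_mul _).add (integrable_const _))
    (ae_of_all _ fun z r hr => by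
      have hr0 := hN0 r hr
      have h1 : HasDerivAt (fun r => √(2 * r)) (√(2 * r))⁻¹ r := by
        have := (((hasDerivAt_id r).const_mul 2).sqrt (by simpa using hr0.ne'))
        convert! this using 1
        simp only [id, mul_one]
        field_simp
      have h2 : HasDerivAt (fun r => x₀ + √(2 * r) • z) ((√(2 * r))⁻¹ • z) r :=
        (h1.smul_const z).const_add x₀
      exact hu.hasDerivAt_comp h2 ((hasDerivAt_id r).const_add t₀) (hsub (hNs r hr)))
  convert! key.2 using 1
  have hi₂ : Integrable (fun z => deriv (fun s => u (x₀ + √(2 * τ) • z) s) (t₀ + τ)) (gauss d) :=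
    integrable_gauss_of_bounded hct fun z => hC₂ _ _ (hNs τ hNτ)
  have hi₁ : Integrable (fun z => fderiv ℝ (fun y => u y (t₀ + τ)) (x₀ + √(2 * τ) • z)
      ((√(2 * τ))⁻¹ • z)) (gauss d) := by
    refine (key.1.sub hi₂).congr (ae_of_all _ fun z => ?_)
    simp
  obtain ⟨C₃, hC₃⟩ := hper.fderiv.fderiv.exists_bound (hvd.continuous_fderiv one_ne_zero)
  have hi₃ : Integrable (fun z => Laplacian.laplacian (fun y => u y (t₀ + τ))
      (x₀ + √(2 * τ) • z)) (gauss d) := by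
    have hpl : IsPeriodic (Laplacian.laplacian fun y => u y (t₀ + τ)) := fun x i => by
      rw [laplacian_eq_sum, laplacian_eq_sum, hper.fderiv.fderiv x i]
    obtain ⟨C₄, hC₄⟩ := hpl.exists_bound (continuous_laplacian hv)
    exact integrable_gauss_of_bounded ((continuous_laplacian hv).comp ha) fun z => hC₄ _
  rw [integral_add hi₂ hi₃, integral_add hi₁ hi₂, add_comm]
  congr 1
  exact (integral_fderiv_gauss hv (C := max C₁ C₃)
    (fun x => (hC₁ x _ (hNs τ hNτ)).trans (le_max_left _ _))
    (fun x => (hC₃ x).trans (le_max_right _ _)) x₀ (Real.sqrt_pos.2 (by linarith))).symm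

end IsClassical

/-! ### The upper bound -/

/-- The heat-kernel factor in the smoothing estimate `L^b → L^∞`, raised to the power `a'`, is
integrable in time precisely because `d / 2 < b (a - 1) / a`. -/
theorem lintegral_heat_factor_lt_top {K T a a' b : ℝ} (hK : 0 < K) (hT : 0 < T)
    (hb : 1 < b) (haa : a.HolderConjugate a') (hab : (d : ℝ) / 2 < b * (a - 1) / a) :
    ∫⁻ τ in Ioo 0 T, (ENNReal.ofReal (K * (√(2 * τ) ^ d)⁻¹) ^ (1 / b)) ^ a' < ⊤ := by
  have ha'0 : 0 < a' := haa.symm.pos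
  have ha0 : 0 < a := haa.pos
  have hb0 : 0 < b := by linarith
  set s : ℝ := a' / b with hs
  have hs1 : (d : ℝ) / 2 * s < 1 := by
    have h1 : a' = a / (a - 1) := haa.conjugate_eq
    have h2 : 0 < a - 1 := by linarith [haa.lt]
    rw [hs, h1]
    rw [lt_div_iff₀ ha0] at hab
    rw [div_div, ← mul_div_assoc, div_lt_one (by positivity)]
    linarith
  have hint : IntegrableOn (fun τ : ℝ => (K * (2 : ℝ) ^ (-((d : ℝ) / 2))) ^ s *
      τ ^ (-((d : ℝ) / 2 * s))) (Ioo 0 T) :=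
    ((intervalIntegral.integrableOn_Ioo_rpow_iff hT).2 (by linarith)).const_mul _
  refine lt_of_eq_of_lt (setLIntegral_congr_fun measurableSet_Ioo fun τ hτ => ?_)
    hint.lintegral_lt_top
  have hτ0 : 0 < τ := hτ.1
  have h2τ : 0 < 2 * τ := by linarith
  have hsq : (√(2 * τ) ^ d)⁻¹ = (2 : ℝ) ^ (-((d : ℝ) / 2)) * τ ^ (-((d : ℝ) / 2)) := by
    rw [← Real.mul_rpow (by norm_num) hτ0.le, Real.rpow_neg h2τ.le, Real.sqrt_eq_rpow,
      ← Real.rpow_natCast, ← Real.rpow_mul h2τ.le]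
    ring_nf
  rw [← ENNReal.rpow_mul, hsq, ← mul_assoc, ENNReal.ofReal_rpow_of_pos (by positivity),
    show 1 / b * a' = s by rw [hs]; ring, Real.mul_rpow (by positivity) (by positivity),
    ← Real.rpow_mul hτ0.le, neg_mul]

/-- Jensen's inequality reduces the `L^b → L^∞` smoothing estimate to the `L^1 → L^∞` one. -/
theorem lintegral_gauss_le_rpow {K b σ : ℝ} (hb : 1 < b) {h : Space d → ℝ≥0∞}
    (hm : Measurable h) (x : Space d)
    (hK : ∫⁻ z, h (x + σ • z) ^ b ∂(gauss d) ≤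
      ENNReal.ofReal (K * (σ ^ d)⁻¹) * ∫⁻ y in cell d, h y ^ b) :
    ∫⁻ z, h (x + σ • z) ∂(gauss d) ≤
      ENNReal.ofReal (K * (σ ^ d)⁻¹) ^ (1 / b) * (∫⁻ y in cell d, h y ^ b) ^ (1 / b) := by
  have hb0 : 0 < b := by linarith
  have h1 := ENNReal.lintegral_mul_le_Lp_mul_Lq (gauss d)
    (Real.HolderConjugate.conjExponent hb)
    (f := fun z => h (x + σ • z)) (g := fun _ => 1)
    (hm.comp (by fun_prop : Measurable fun z : Space d => x + σ • z)).aemeasurable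
    aemeasurable_const
  simp only [Pi.mul_apply, mul_one, ENNReal.one_rpow, lintegral_const, measure_univ] at h1
  refine h1.trans ?_
  rw [← ENNReal.mul_rpow_of_nonneg _ _ (by positivity)]
  exact ENNReal.rpow_le_rpow hK (by positivity)

/-- Duhamel's inequality: along the backward heat flow, a subsolution exceeds its terminal bound by
at most the time integral of any majorant `W` of the Gaussian averages of the source. -/
theorem IsClassical.le_add_lintegral {T : ℝ} {u : Space d → ℝ → ℝ} (hu : IsClassical T u)
    {M t₀ : ℝ} (ht₀ : t₀ ∈ Ioo 0 T) (x₀ : Space d) (hM : ∀ x, u x T ≤ M)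
    {f : Space d → ℝ → ℝ} (hf : ∀ t ∈ Ioo 0 T, Continuous fun x => f x t)
    (hper : ∀ t ∈ Ioo 0 T, IsPeriodic fun x => f x t)
    (hf0 : ∀ x, ∀ t ∈ Ioo 0 T, 0 ≤ f x t)
    (hle : ∀ x, ∀ t ∈ Ioo 0 T, -deriv (fun s => u x s) t -
      Laplacian.laplacian (fun y => u y t) x ≤ f x t)
    {W : ℝ → ℝ≥0∞} (hWm : Measurable W) (hW : ∀ τ ∈ Ioo 0 (T - t₀), W τ ≠ ⊤)
    (hfW : ∀ τ ∈ Ioo 0 (T - t₀),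
      ∫⁻ z, ENNReal.ofReal (f (x₀ + √(2 * τ) • z) (t₀ + τ)) ∂(gauss d) ≤ W τ) :
    ENNReal.ofReal (u x₀ t₀ - M) ≤ ∫⁻ τ in Ioo 0 (T - t₀), W τ := by
  by_cases htop : ∫⁻ τ in Ioo 0 (T - t₀), W τ = ⊤
  · rw [htop]; exact le_top
  have hTt : 0 ≤ T - t₀ := by linarith [ht₀.2]
  set φ : ℝ → ℝ := fun r => ∫ z, u (x₀ + √(2 * r) • z) (t₀ + r) ∂(gauss d) with hφ
  have hint : IntegrableOn (fun τ => (W τ).toReal) (Icc 0 (T - t₀)) := by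
    rw [integrableOn_Icc_iff_integrableOn_Ioo]
    exact integrable_toReal_of_lintegral_ne_top hWm.aemeasurable htop
  have key := intervalIntegral.sub_le_integral_of_hasDeriv_right_of_le (g := fun r => -φ r) hTt
    (hu.continuousOn_gaussAverage ht₀.1.le x₀).neg
    (fun τ hτ => (hu.hasDerivAt_gaussAverage ht₀.1 x₀ hτ).neg.hasDerivWithinAt) hint ?_
  · have h0 : φ 0 = u x₀ t₀ := by simp [hφ]
    have h1 : φ (T - t₀) ≤ M := by
      have hc : Continuous fun x => u x T := hu.continuous_slice ⟨by linarith [ht₀.1, ht₀.2], le_rfl⟩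
      obtain ⟨B, hB⟩ := hu.exists_bound
      have h2 : Integrable (fun z => u (x₀ + √(2 * (T - t₀)) • z) T) (gauss d) :=
        integrable_gauss_of_bounded (hc.comp (by fun_prop))
          fun z => hB _ _ ⟨by linarith [ht₀.1, ht₀.2], le_rfl⟩
      have h3 := integral_mono h2 (integrable_const M) fun z => hM _
      simpa [hφ] using h3
    rw [intervalIntegral.integral_of_le hTt, integral_Ioc_eq_integral_Ioo,
      integral_toReal hWm.aemeasurable
        (ae_restrict_of_forall_mem measurableSet_Ioo fun τ hτ => (hW τ hτ).lt_top)] at key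
    refine ENNReal.ofReal_le_of_le_toReal ?_
    linarith
  · intro τ hτ
    have ht : t₀ + τ ∈ Ioo 0 T := ⟨by linarith [ht₀.1, hτ.1], by linarith [hτ.2]⟩
    obtain ⟨B, hB⟩ := (hper _ ht).exists_bound (hf _ ht)
    have hfi : Integrable (fun z => f (x₀ + √(2 * τ) • z) (t₀ + τ)) (gauss d) :=
      integrable_gauss_of_bounded ((hf _ ht).comp (by fun_prop)) fun z => hB _
    have h1 : ∫ z, f (x₀ + √(2 * τ) • z) (t₀ + τ) ∂(gauss d) ≤ (W τ).toReal := by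
      rw [integral_eq_lintegral_of_nonneg_ae (ae_of_all _ fun z => hf0 _ _ ht)
        hfi.aestronglyMeasurable]
      exact ENNReal.toReal_mono (hW τ hτ) (hfW τ hτ)
    refine le_trans ?_ h1
    rw [← integral_neg]
    by_cases hi : Integrable (fun z => -(deriv (fun s => u (x₀ + √(2 * τ) • z) s) (t₀ + τ) +
        Laplacian.laplacian (fun y => u y (t₀ + τ)) (x₀ + √(2 * τ) • z))) (gauss d)
    · refine integral_mono hi hfi fun z => ?_
      have := hle (x₀ + √(2 * τ) • z) _ ht
      dsimp only
      linarith
    · rw [integral_undef hi]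
      exact integral_nonneg fun z => hf0 _ _ ht

theorem measurable_indicator_slab {T : ℝ} {f : Space d → ℝ → ℝ}
    (hf : ContinuousOn (fun z : Space d × ℝ => f z.1 z.2) (univ ×ˢ Ioo 0 T)) :
    Measurable (indicator ((univ : Set (Space d)) ×ˢ Ioo (0 : ℝ) T)
      fun z => ENNReal.ofReal (f z.1 z.2)) := by
  classical
  rw [← piecewise_eq_indicator]
  exact (ENNReal.continuous_ofReal.comp_continuousOn hf).measurable_piecewise
    continuousOn_const (MeasurableSet.univ.prod measurableSet_Ioo)

/-- The mixed norm through a globally measurable extension of `f` by zero, so that the measurability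
needed for Hölder's and Tonelli's theorems is available without restricting to the slab. -/
theorem mixedNorm_eq {T a b : ℝ} (ha : 0 < a) (hb : 0 < b) {f : Space d → ℝ → ℝ}
    (hf0 : ∀ x, ∀ t ∈ Ioo 0 T, 0 ≤ f x t) :
    mixedNorm T (ENNReal.ofReal a) (ENNReal.ofReal b) f =
      (∫⁻ t in Ioo 0 T, ((∫⁻ x in cell d, indicator ((univ : Set (Space d)) ×ˢ Ioo (0 : ℝ) T)
        (fun z => ENNReal.ofReal (f z.1 z.2)) (x, t) ^ b) ^ (1 / b)) ^ a) ^ (1 / a) := by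
  have hne : ∀ {c : ℝ}, 0 < c → ENNReal.ofReal c ≠ 0 := fun hc => by simpa using hc
  rw [mixedNorm, eLpNorm_eq_lintegral_rpow_enorm_toReal (hne ha) ENNReal.ofReal_ne_top,
    ENNReal.toReal_ofReal ha.le]
  congr 1
  refine setLIntegral_congr_fun measurableSet_Ioo fun t ht => ?_
  rw [eLpNorm_eq_lintegral_rpow_enorm_toReal (hne hb) ENNReal.ofReal_ne_top,
    ENNReal.toReal_ofReal hb.le, enorm_eq_self, torusMeasure]
  congr 2
  refine lintegral_congr fun x => ?_
  rw [indicator_of_mem (show (x, t) ∈ (univ : Set (Space d)) ×ˢ Ioo (0 : ℝ) T from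
    ⟨mem_univ _, ht⟩), Real.enorm_of_nonneg (hf0 x t ht)]

/-- Sup bound for non-negatively forced subsolutions of the backward heat equation. -/
theorem exists_subsolution_bound (d : ℕ) {T a b : ℝ} (hT : 0 < T) (ha : 1 < a) (hb : 1 < b)
    (hab : (d : ℝ) / 2 < b * (a - 1) / a) :
    ∃ C : ℝ, 0 < C ∧ ∀ u f : Space d → ℝ → ℝ, IsClassical T u →
      ContinuousOn (fun z : Space d × ℝ => f z.1 z.2) (univ ×ˢ Ioo 0 T) →
      (∀ t ∈ Ioo 0 T, IsPeriodic fun x => f x t) →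
      (∀ x, ∀ t ∈ Ioo 0 T, 0 ≤ f x t) →
      (∀ x, ∀ t ∈ Ioo 0 T, -deriv (fun s => u x s) t -
        Laplacian.laplacian (fun y => u y t) x ≤ f x t) →
      ∀ M, (∀ x, u x T ≤ M) → ∀ x, ∀ t ∈ Ioo 0 T,
        ENNReal.ofReal (u x t - M) ≤
          ENNReal.ofReal C * mixedNorm T (ENNReal.ofReal a) (ENNReal.ofReal b) f := by
  have ha0 : 0 < a := by linarith
  have hb0 : 0 < b := by linarith
  have haa := Real.HolderConjugate.conjExponent ha
  set a' := a.conjExponent with ha'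
  obtain ⟨K, hK, hKle⟩ := exists_lintegral_gauss_le d (S := √(2 * T)) (by positivity)
  set k : ℝ → ℝ≥0∞ := fun τ => ENNReal.ofReal (K * (√(2 * τ) ^ d)⁻¹) ^ (1 / b) with hk
  have hkm : Measurable k := by fun_prop
  have hfin : ∫⁻ τ in Ioo 0 T, k τ ^ a' < ⊤ := lintegral_heat_factor_lt_top hK hT hb haa hab
  set A : ℝ≥0∞ := (∫⁻ τ in Ioo 0 T, k τ ^ a') ^ (1 / a') with hA
  have hAtop : A ≠ ⊤ := (ENNReal.rpow_lt_top_of_nonneg (by have := haa.symm.pos; positivity)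
    hfin.ne).ne
  -- the summand `1` only makes the constant positive
  refine ⟨A.toReal + 1, by positivity, ?_⟩
  intro u f hu hfc hper hf0 hle M hM x₀ t₀ ht₀
  set g : Space d × ℝ → ℝ≥0∞ := indicator ((univ : Set (Space d)) ×ˢ Ioo (0 : ℝ) T)
    (fun z => ENNReal.ofReal (f z.1 z.2)) with hg
  have hgm : Measurable g := measurable_indicator_slab hfc
  have hgf : ∀ x, ∀ t ∈ Ioo 0 T, g (x, t) = ENNReal.ofReal (f x t) := fun x t ht =>
    indicator_of_mem (show (x, t) ∈ (univ : Set (Space d)) ×ˢ Ioo (0 : ℝ) T from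
      ⟨mem_univ _, ht⟩) _
  have hfs : ∀ t ∈ Ioo 0 T, Continuous fun x => f x t := fun t ht =>
    hfc.comp_continuous (f := fun x : Space d => (x, t)) (by fun_prop) fun _ => ⟨mem_univ _, ht⟩
  set N : ℝ → ℝ≥0∞ := fun t => (∫⁻ x in cell d, g (x, t) ^ b) ^ (1 / b) with hN
  have hNm : Measurable N :=
    ((hgm.pow_const b).lintegral_prod_left' (μ := volume.restrict (cell d))).pow_const _
  have hNtop : ∀ t ∈ Ioo 0 T, N t ≠ ⊤ := fun t ht => by
    obtain ⟨B, hB⟩ := (hper t ht).exists_bound (hfs t ht)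
    refine (ENNReal.rpow_lt_top_of_nonneg (by positivity) (ne_of_lt ?_)).ne
    calc ∫⁻ x in cell d, g (x, t) ^ b ≤ ∫⁻ _x in cell d, ENNReal.ofReal B ^ b := by
          refine setLIntegral_mono measurable_const fun x _ => ?_
          rw [hgf x t ht]
          exact ENNReal.rpow_le_rpow (ENNReal.ofReal_le_ofReal
            ((le_abs_self _).trans (hB x))) hb0.le
      _ < ⊤ := by
          rw [setLIntegral_const, volume_cell, mul_one]
          exact ENNReal.rpow_lt_top_of_nonneg hb0.le ENNReal.ofReal_ne_top
  have hmem : ∀ τ ∈ Ioo 0 (T - t₀), t₀ + τ ∈ Ioo 0 T := fun τ hτ =>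
    ⟨by linarith [ht₀.1, hτ.1], by linarith [hτ.2]⟩
  have h1 := hu.le_add_lintegral ht₀ x₀ hM hfs hper hf0 hle
    (W := fun τ => k τ * N (t₀ + τ)) (hkm.mul (hNm.comp (measurable_const_add t₀)))
    (fun τ hτ => ENNReal.mul_ne_top
      (ENNReal.rpow_lt_top_of_nonneg (by positivity) ENNReal.ofReal_ne_top).ne
      (hNtop _ (hmem τ hτ)))
    (fun τ hτ => by
      have ht := hmem τ hτ
      have hgp : IsPeriodic fun x => g (x, t₀ + τ) := fun x i => by
        dsimp only
        rw [hgf _ _ ht, hgf _ _ ht]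
        exact congrArg ENNReal.ofReal (hper _ ht x i)
      have hgs : Measurable fun x => g (x, t₀ + τ) := hgm.comp (by fun_prop)
      have h2 := lintegral_gauss_le_rpow (K := K) (σ := √(2 * τ)) hb hgs x₀
        (hKle (fun x => g (x, t₀ + τ) ^ b) (fun x i => congrArg (· ^ b) (hgp x i))
          (hgs.pow_const b) _ (Real.sqrt_pos.2 (by linarith [hτ.1]))
          (Real.sqrt_le_sqrt (by linarith [hτ.2, ht₀.1])) x₀)
      simpa only [hgf _ _ ht, hk, hN] using h2)
  have h3 := ENNReal.lintegral_mul_le_Lp_mul_Lq (volume.restrict (Ioo 0 (T - t₀))) haa.symm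
    (f := k) (g := fun τ => N (t₀ + τ)) hkm.aemeasurable
    (hNm.comp (measurable_const_add t₀)).aemeasurable
  refine h1.trans (h3.trans ?_)
  refine mul_le_mul' ?_ ?_
  · calc _ ≤ A := ENNReal.rpow_le_rpow
          (lintegral_mono_set (Ioo_subset_Ioo_right (by linarith [ht₀.1])))
          (by have := haa.symm.pos; positivity)
      _ = ENNReal.ofReal A.toReal := (ENNReal.ofReal_toReal hAtop).symm
      _ ≤ _ := ENNReal.ofReal_le_ofReal (by linarith)
  · rw [mixedNorm_eq ha0 hb0 hf0]
    refine ENNReal.rpow_le_rpow ?_ (by positivity)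
    have h4 := (measurePreserving_add_left (volume : Measure ℝ) t₀).setLIntegral_comp_preimage_emb
      (measurableEmbedding_addLeft t₀) (fun t => N t ^ a) (Ioo t₀ T)
    have h5 : (fun τ => t₀ + τ) ⁻¹' Ioo t₀ T = Ioo 0 (T - t₀) := by
      ext τ
      simp only [mem_preimage, mem_Ioo]
      constructor <;> rintro ⟨h, h'⟩ <;> constructor <;> linarith
    rw [h5] at h4
    rw [h4]
    exact lintegral_mono_set (Ioo_subset_Ioo_left ht₀.1.le)

/-! ### The lower bound -/

theorem hasDerivAt_add_smul (x e : Space d) (s : ℝ) :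
    HasDerivAt (fun s : ℝ => x + s • e) e s := by
  simpa using ((hasDerivAt_id s).smul_const e).const_add x

/-- Second-order necessary condition at a minimum, in terms of the Laplacian. -/
theorem laplacian_nonneg_of_isMin {v : Space d → ℝ} (hv : ContDiff ℝ 2 v) {x : Space d}
    (hmin : ∀ y, v x ≤ v y) : 0 ≤ Laplacian.laplacian v x := by
  rw [laplacian_eq_sum]
  refine Finset.sum_nonneg fun i _ => ?_
  set e : Space d := basisVec i
  have hvd : ContDiff ℝ 1 (fderiv ℝ v) := hv.fderiv_right (m := 1) (by norm_num)
  have h1 : deriv (fun s : ℝ => v (x + s • e)) = fun s => fderiv ℝ v (x + s • e) e :=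
    funext fun s => ((hv.differentiable two_ne_zero _).hasFDerivAt.comp_hasDerivAt s
      (hasDerivAt_add_smul x e s)).deriv
  have h2 : deriv (deriv fun s : ℝ => v (x + s • e)) 0 = fderiv ℝ (fderiv ℝ v) x e e := by
    rw [h1]
    have h3 : HasDerivAt (fun s : ℝ => fderiv ℝ v (x + s • e))
        (fderiv ℝ (fderiv ℝ v) (x + (0 : ℝ) • e) e) 0 :=
      (hvd.differentiable one_ne_zero _).hasFDerivAt.comp_hasDerivAt (0 : ℝ)
        (hasDerivAt_add_smul x e 0)
    have h4 : HasDerivAt (fun s : ℝ => fderiv ℝ v (x + s • e) e) _ 0 :=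
      (ContinuousLinearMap.apply ℝ ℝ e).hasFDerivAt.comp_hasDerivAt (0 : ℝ) h3
    rw [h4.deriv]
    simp
  have hlm : IsLocalMin (fun s : ℝ => v (x + s • e)) 0 :=
    Filter.Eventually.of_forall fun s => by simpa using hmin (x + s • e)
  by_contra! hneg
  rw [← h2] at hneg
  -- a negative second derivative makes the minimum also a local maximum, hence the restriction
  -- to the line is locally constant
  have hlM := isLocalMax_of_deriv_deriv_neg hneg hlm.deriv_eq_zero
    (hv.continuous.comp (by fun_prop)).continuousAt
  have hconst : (fun s : ℝ => v (x + s • e)) =ᶠ[𝓝 0] fun _ => v (x + (0 : ℝ) • e) := by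
    filter_upwards [hlm, hlM] with s hs hs'
    exact le_antisymm hs' hs
  rw [hconst.deriv.deriv_eq] at hneg
  simp at hneg

/-- Minimum principle. The equation only has to be controlled where the spatial gradient
vanishes. The slope `M + 1` of the comparison function, rather than `M`, makes the contradiction at
an interior minimum strict. -/
theorem IsClassical.le_of_critical {T : ℝ} {u : Space d → ℝ → ℝ} (hu : IsClassical T u) {M m : ℝ}
    (hm : ∀ x, m ≤ u x T)
    (hcrit : ∀ x, ∀ t ∈ Ioo 0 T, fderiv ℝ (fun y => u y t) x = 0 →
      deriv (fun s => u x s) t + Laplacian.laplacian (fun y => u y t) x ≤ M)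
    (x : Space d) {t : ℝ} (ht : t ∈ Ioo 0 T) : m - (M + 1) * (T - t) ≤ u x t := by
  have hsub : Icc t T ⊆ Icc 0 T := Icc_subset_Icc_left ht.1.le
  have hcont : ContinuousOn (fun z : Space d × ℝ => u z.1 z.2 + (M + 1) * (T - z.2))
      (closure (cell d) ×ˢ Icc t T) :=
    (hu.continuousOn.mono (prod_mono (subset_univ _) hsub)).add (by fun_prop)
  obtain ⟨x', hx', hxx⟩ := (hu.periodic t (Ioo_subset_Icc_self ht)).exists_mem_cell x
  obtain ⟨⟨y, s⟩, ⟨-, hs⟩, hmin⟩ := (isCompact_closure_cell.prod isCompact_Icc).exists_isMinOn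
    ⟨(x', t), subset_closure hx', left_mem_Icc.2 ht.2.le⟩ hcont
  have hmin' : ∀ z, ∀ r ∈ Icc t T, u y s + (M + 1) * (T - s) ≤ u z r + (M + 1) * (T - r) := by
    intro z r hr
    obtain ⟨z', hz', hzz⟩ := (hu.periodic r (hsub hr)).exists_mem_cell z
    have h1 : u y s + (M + 1) * (T - s) ≤ u z' r + (M + 1) * (T - r) :=
      hmin (show (z', r) ∈ closure (cell d) ×ˢ Icc t T from ⟨subset_closure hz', hr⟩)
    have hzz' : u z' r = u z r := hzz
    rwa [hzz'] at h1
  have hfin := hmin' x t (left_mem_Icc.2 ht.2.le)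
  suffices h : m ≤ u y s + (M + 1) * (T - s) by linarith
  rcases hs.2.eq_or_lt with rfl | hsT
  · simpa using hm y
  exfalso
  have hs' : s ∈ Ioo 0 T := ⟨ht.1.trans_le hs.1, hsT⟩
  have hminx : ∀ z, u y s ≤ u z s := fun z => by linarith [hmin' z s hs]
  have hlm : IsLocalMin (fun z => u z s) y := Filter.Eventually.of_forall hminx
  have h1 := hcrit y s hs' hlm.fderiv_eq_zero
  have h2 := laplacian_nonneg_of_isMin (hu.contDiff_space s hs') hminx
  have h3 : HasDerivAt (fun r => u y r + (M + 1) * (T - r))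
      (deriv (fun r => u y r) s + (M + 1) * (-1)) s :=
    (hu.differentiable_time y s hs').hasDerivAt.add
      (((hasDerivAt_id s).const_sub T).const_mul (M + 1))
  have h4 : 0 ≤ deriv (fun r => u y r) s + (M + 1) * (-1) := by
    have h5 := (hasDerivWithinAt_iff_tendsto_slope' (by simp)).1 (h3.hasDerivWithinAt (s := Ioi s))
    refine ge_of_tendsto h5 ?_
    filter_upwards [Ioo_mem_nhdsGT hsT] with r hr
    rw [slope_def_field]
    have := hmin' y r ⟨hs.1.trans hr.1.le, hr.2.le⟩
    exact div_nonneg (by linarith) (by linarith [hr.1])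
  linarith

/-! ### The regularized coupling -/

theorem mollify_nonneg {η : Space d → ℝ} (hη : ∀ z, 0 ≤ η z) {ε : ℝ} (hε : 0 ≤ ε)
    {f : Space d → ℝ} (hf : ∀ x, 0 ≤ f x) (x : Space d) : 0 ≤ mollify η ε f x := by
  unfold mollify
  split_ifs
  · exact hf x
  · exact integral_nonneg fun y => mul_nonneg (mul_nonneg (by positivity) (hη _)) (hf y)

theorem regCoupling_nonneg {η : Space d → ℝ} (hη : ∀ z, 0 ≤ η z) {ε : ℝ} (hε : 0 ≤ ε)
    {g : ℝ → ℝ} (hg : ∀ z, 0 ≤ z → 0 ≤ g z) {m : Space d → ℝ → ℝ} {t : ℝ}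
    (hm : ∀ x, 0 ≤ m x t) (x : Space d) : 0 ≤ regCoupling η g ε m x t :=
  mollify_nonneg hη hε (fun _ => hg _ (mollify_nonneg hη hε hm _)) x

section Solution

variable {T ε : ℝ} {H : Space d → Space d → ℝ} {g : ℝ → ℝ} {u₀ m₀ η : Space d → ℝ}
  {u m : Space d → ℝ → ℝ}

theorem IsSolution.regCoupling_eq (h : IsSolution T H g u₀ m₀ η ε u m) (x : Space d) {t : ℝ}
    (ht : t ∈ Ioo 0 T) :
    regCoupling η g ε m x t = -deriv (fun s => u x s) t +
      H x ((InnerProductSpace.toDual ℝ (Space d)).symm (fderiv ℝ (fun y => u y t) x)) -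
      Laplacian.laplacian (fun y => u y t) x := by
  have := h.hamiltonJacobi x t ht
  rw [gradient] at this
  linarith

/-- The coupling inherits continuity on the open slab from the Hamilton–Jacobi equation. -/
theorem IsSolution.continuousOn_regCoupling (h : IsSolution T H g u₀ m₀ η ε u m)
    (hH : IsHamiltonian H) :
    ContinuousOn (fun z : Space d × ℝ => regCoupling η g ε m z.1 z.2) (univ ×ˢ Ioo 0 T) := by
  have h1 : ContinuousOn (fun z : Space d × ℝ => -deriv (fun s => u z.1 s) z.2 +
      H z.1 ((InnerProductSpace.toDual ℝ (Space d)).symm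
        (fderiv ℝ (fun y => u y z.2) z.1)) -
      Laplacian.laplacian (fun y => u y z.2) z.1) (univ ×ˢ Ioo 0 T) := by
    refine (h.classical_u.continuousOn_dt.neg.add ?_).sub h.classical_u.continuousOn_laplacian
    exact hH.smooth.continuous.comp_continuousOn (continuousOn_fst.prodMk
      ((InnerProductSpace.toDual ℝ (Space d)).symm.continuous.comp_continuousOn
        h.classical_u.continuousOn_dx))
  exact h1.congr fun z hz => h.regCoupling_eq z.1 hz.2

theorem IsSolution.periodic_regCoupling (h : IsSolution T H g u₀ m₀ η ε u m)
    (hH : IsHamiltonian H) {t : ℝ} (ht : t ∈ Ioo 0 T) :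
    IsPeriodic fun x => regCoupling η g ε m x t := by
  have hp := h.classical_u.periodic t (Ioo_subset_Icc_self ht)
  intro x i
  have h1 : deriv (fun s => u (x + basisVec i) s) t = deriv (fun s => u x s) t :=
    h.classical_u.periodic_deriv ht x i
  have h2 : ∀ p, H (x + basisVec i) p = H x p := fun p => hH.periodic p x i
  dsimp only
  rw [h.regCoupling_eq _ ht, h.regCoupling_eq _ ht, h1, hp.fderiv x i, h2,
    laplacian_eq_sum, laplacian_eq_sum, hp.fderiv.fderiv x i]

end Solution

end

end MFG

theorem lemma1p3 (d : ℕ) (hd : 2 < d) (T : ℝ) (hT : 0 < T)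
    (H : MFG.Space d → MFG.Space d → ℝ) (g : ℝ → ℝ) (u₀ m₀ η : MFG.Space d → ℝ)
    (hH : MFG.IsHamiltonian H) (hdata : MFG.IsInitialTerminalData u₀ m₀)
    (hg : MFG.IsCoupling g) (hL : MFG.LagrangianLowerBound H)
    (hpow : MFG.IsPowerCoupling g) (hder : MFG.HamiltonianDerivBounds H)
    (hm₀ : MFG.IsBoundedBelow m₀) (hgrowth : MFG.SubquadraticGrowth H)
    (hη : MFG.IsMollifier η)
    (a b : ℝ) (ha : 1 < a) (hb : 1 < b) (hab : (d : ℝ) / 2 < b * (a - 1) / a) :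
    ∃ C : ℝ, 0 < C ∧ ∀ ε : ℝ, 0 ≤ ε → ∀ u m : MFG.Space d → ℝ → ℝ,
      MFG.IsSolution T H g u₀ m₀ η ε u m →
        MFG.mixedNorm T ⊤ ⊤ u ≤ ENNReal.ofReal C + ENNReal.ofReal C *
          MFG.mixedNorm T (ENNReal.ofReal a) (ENNReal.ofReal b) (MFG.regCoupling η g ε m) := by
  obtain ⟨C₁, hC₁, hupper⟩ := MFG.exists_subsolution_bound d hT ha hb hab
  obtain ⟨B, hB⟩ := hdata.periodic_u.exists_bound hdata.smooth_u.continuous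
  obtain ⟨K, hK⟩ := (hH.periodic 0).exists_bound
    (hH.smooth.continuous.comp (continuous_id.prodMk continuous_const))
  have hK' : ∀ x, H x 0 ≤ K := fun x => (le_abs_self _).trans (hK x)
  have hB0 : 0 ≤ B := (abs_nonneg _).trans (hB 0)
  have hK0 : 0 ≤ K := by linarith [hK' 0, hH.one_le 0 0]
  have hKT : 0 ≤ (K + 1) * T := by positivity
  refine ⟨B + (K + 1) * T + C₁, by positivity, ?_⟩
  intro ε hε u m hsol
  have hf0 : ∀ x, ∀ t ∈ Ioo 0 T, 0 ≤ MFG.regCoupling η g ε m x t := fun x t ht =>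
    MFG.regCoupling_nonneg hη.nonneg hε hg.1
      (fun y => hsol.nonneg_m y t (Ioo_subset_Icc_self ht)) x
  set N := MFG.mixedNorm T (ENNReal.ofReal a) (ENNReal.ofReal b) (MFG.regCoupling η g ε m)
  have hpt : ∀ x, ∀ t ∈ Ioo 0 T, ‖u x t‖ₑ ≤ ENNReal.ofReal (B + (K + 1) * T + C₁) +
      ENNReal.ofReal (B + (K + 1) * T + C₁) * N := by
    intro x t ht
    have hup := hupper u (MFG.regCoupling η g ε m) hsol.classical_u
      (hsol.continuousOn_regCoupling hH) (fun t ht => hsol.periodic_regCoupling hH ht) hf0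
      (fun y s hs => by
        rw [hsol.regCoupling_eq y hs]
        linarith [hH.one_le y ((InnerProductSpace.toDual ℝ (MFG.Space d)).symm
          (fderiv ℝ (fun z => u z s) y))])
      B (fun y => by rw [hsol.terminal]; exact (abs_le.1 (hB y)).2) x t ht
    have hlow := hsol.classical_u.le_of_critical (M := K) (m := -B)
      (fun y => by rw [hsol.terminal]; exact (abs_le.1 (hB y)).1)
      (fun y s hs hcr => by
        have h1 := hsol.regCoupling_eq y hs
        rw [hcr, map_zero] at h1
        linarith [hf0 y s hs, hK' y]) x ht
    have hKt : (K + 1) * (T - t) ≤ (K + 1) * T :=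
      mul_le_mul_of_nonneg_left (by linarith [ht.1]) (by linarith)
    rcases le_total 0 (u x t) with h0 | h0
    · rw [Real.enorm_of_nonneg h0]
      calc ENNReal.ofReal (u x t) = ENNReal.ofReal (B + (u x t - B)) := by ring_nf
        _ ≤ ENNReal.ofReal B + ENNReal.ofReal (u x t - B) := ENNReal.ofReal_add_le
        _ ≤ ENNReal.ofReal B + ENNReal.ofReal C₁ * N := by gcongr
        _ ≤ _ := by gcongr <;> linarith
    · rw [← enorm_neg, Real.enorm_of_nonneg (by linarith)]
      exact (ENNReal.ofReal_le_ofReal (by linarith)).trans le_self_add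
  rw [MFG.mixedNorm, eLpNorm_exponent_top]
  refine essSup_le_of_ae_le _ (ae_restrict_of_forall_mem measurableSet_Ioo fun t ht => ?_)
  change eLpNorm (fun x => u x t) ⊤ (MFG.torusMeasure d) ≤ _
  rw [eLpNorm_exponent_top]
  exact essSup_le_of_ae_le _ (ae_of_all _ fun x => hpt x t ht)
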